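/- Fix an index $q\in\{1,2\}$, signs $\varepsilon_1,\varepsilon_2\in\{1,-1\}$ exactly $q-1$ of which are $-1$, a constant $a>0$ and a nondegenerate interval $I\subseteq\mathbb{R}$. Let $\Lambda$ be the set of smooth null curves $\gamma:I\to\mathbb{R}^4_q$ in the pseudo-Euclidean space of index $q$, parametrized by the pseudo arc-length parameter $\sigma$ normalized by $a$ (that is, $\langle\gamma'',\gamma''\rangle=\varepsilon_1a^2$), that carry a (positively oriented) Cartan frame $T=\gamma',W_1,N,W_2$ with $\langle T,T\rangle=\langle N,N\rangle=\langle W_i,T\rangle=\langle W_i,N\rangle=\langle W_1,W_2\rangle=0$, $\langle T,N\rangle=-1$, $\langle W_i,W_i\rangle=\varepsilon_i$ and $$T'=aW_1,\quad W_1'=-k_1T+a\varepsilon_1N,\quad N'=-\varepsilon_1k_1W_1+\varepsilon_2k_2W_2,\quad W_2'=k_2T,$$ where $k_1,k_2$ are smooth functions on $I$ (the curvatures). Let $\mathcal P=\mathbb R[k_1^{(m)},k_2^{(n)}:m,n\in\mathbb N]$ be the algebra of differential polynomials in the curvatures, with the derivation $f\mapsto f'$, $(k_i^{(m)})'=k_i^{(m+1)}$.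 A $\mathcal P$-local vector field along $\gamma$ is $V=fT+hW_1+gN+lW_2$ with $f,h,g,l\in\mathcal P$; write $f_V,h_V,g_V,l_V$ for its components. The covariant derivative $\nabla_TV$ is computed by the Leibniz rule and the equations above. Put $\varphi_V=\varepsilon_1\langle\nabla_TV,W_1\rangle$, $\psi_V=\varepsilon_2\langle\nabla_TV,W_2\rangle$, $\rho_V=-\varepsilon_1\langle\nabla_T^2V,W_1\rangle$, $\alpha_V=\frac1a(\varphi_V'+\frac12\rho_V)$, $\beta_V=\frac1a(\alpha_V'+k_1\varphi_V-k_2\psi_V)$, $\delta_V=\frac1a\psi_V''+k_1\psi_V+\varepsilon_1\varepsilon_2k_2\varphi_V$. Then $V$ acts on $\mathcal P$ as the derivation determined by $V(f')=V(f)'+\frac1{2a}\rho_Vf'$ and $$V(k_1)=\tfrac1{a^2}\varphi_V'''+\tfrac1a[(k_1\varphi_V)'+k_1\varphi_V']-\tfrac1a[(k_2\psi_V)'+k_2\psi_V']+\tfrac1a[\tfrac1{2a}\rho_V''+k_1\rho_V],$$ $$V(k_2)=\tfrac{\varepsilon_1\varepsilon_2}{a^2}\psi_V'''+\tfrac{\varepsilon_1\varepsilon_2}a[(k_1\psi_V)'+k_1\psi_V']+\tfrac1a[(k_2\varphi_V)'+k_2\varphi_V']+\tfrac1ak_2\rho_V,$$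 and $D_V$ is the tensor derivation on $\mathcal P$-local vector fields, $D_V(fU)=V(f)U+fD_VU$, with $$\begin{aligned}D_VT&=-\alpha_VT+\varphi_VW_1+\psi_VW_2,& D_VW_1&=-\beta_VT+\varepsilon_1\varphi_VN+\tfrac1a\psi_V'W_2,\\ D_VN&=-\varepsilon_1\beta_VW_1+\alpha_VN+\tfrac{\varepsilon_1}a\delta_VW_2,& D_VW_2&=\tfrac{\varepsilon_1\varepsilon_2}a\delta_VT-\tfrac{\varepsilon_1\varepsilon_2}a\psi_V'W_1+\varepsilon_2\psi_VN.\end{aligned}$$ Put $[V,U]_\gamma=D_VU-D_UV$. Let $\mathcal A$ be the algebra of $\mathcal P$-valued scalar fields $\mathbf f:\gamma\mapsto\mathbf f_\gamma$ on $\Lambda$. An $\mathcal A$-local vector field $\mathbf V$ on $\Lambda$ assigns to each $\gamma\in\Lambda$ a $\mathcal P$-local vector field $\mathbf V_\gamma$ along $\gamma$, and acts on $\mathcal A$ by $\mathbf V(\mathbf f)(\gamma)=\mathbf V_\gamma(\mathbf f_\gamma)$. Let $\mathfrak X^*_{\mathcal A}(\Lambda)$ be the space of those $\mathbf V=\mathbf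 fT+\mathbf hW_1+\mathbf gN+\mathbf lW_2$ with $\mathbf h=-\frac{\varepsilon_1}a\mathbf g'$ (they locally preserve the causal character), and let $\mathfrak X_{\mathcal A}(\Lambda)$ be the space of evolution vector fields, that is, of those $\mathbf V\in\mathfrak X^*_{\mathcal A}(\Lambda)$ with $\mathbf f=\frac1{2a}[\frac{\varepsilon_1}a\mathbf g''+\mathbf p]$ for some $\mathbf p\in\mathcal A$ with $\mathbf p'=\varepsilon_1k_1'\mathbf g-ak_2\mathbf l$. Then $[\mathbf V,\mathbf U](\gamma)=[\mathbf V_\gamma,\mathbf U_\gamma]_\gamma$ defines a map $\mathfrak X^*_{\mathcal A}(\Lambda)\times\mathfrak X^*_{\mathcal A}(\Lambda)\to\mathfrak X^*_{\mathcal A}(\Lambda)$ which is a Lie bracket ($\mathbb R$-bilinear, alternating, and satisfying the Jacobi identity), so that $(\mathfrak X^*_{\mathcal A}(\Lambda),[\cdot,\cdot])$ is a real Lie algebra, and: (a) $[\mathbf V,\mathbf U](\mathbf f)=\mathbf V(\mathbf U(\mathbf f))-\mathbf U(\mathbf V(\mathbf f))$ for all $\mathbf V,\mathbf U\in\mathfrak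 X^*_{\mathcal A}(\Lambda)$ and $\mathbf f\in\mathcal A$; (b) if $\mathbf V,\mathbf U\in\mathfrak X_{\mathcal A}(\Lambda)$, then $[\mathbf V,\mathbf U]\in\mathfrak X_{\mathcal A}(\Lambda)$; hence the evolution vector fields form a Lie subalgebra of $\mathfrak X^*_{\mathcal A}(\Lambda)$. -/

import Mathlib

open scoped ContDiff

noncomputable section

namespace NullCurves

/-! ### Background: pseudo-Euclidean space of dimension four and null curves in it -/

/-- The constants that are fixed throughout: the index `q` of the pseudo-Euclidean space
`ℝ⁴_q` (one or two), the causal characters `ε₁ = ⟨W₁, W₁⟩`, `ε₂ = ⟨W₂, W₂⟩` of the two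
screen vectors of a Cartan frame (`T, N` span a plane of index one, so that `q - 1` of the two
signs are negative), and the constant `a > 0` that normalizes the pseudo arc-length. -/
structure Background where
  q : ℕ
  ε₁ : ℝ
  ε₂ : ℝ
  a : ℝ
  a_pos : 0 < a
  signs : (q = 1 ∧ ε₁ = 1 ∧ ε₂ = 1) ∨ (q = 2 ∧ ε₁ = 1 ∧ ε₂ = -1) ∨
    (q = 2 ∧ ε₁ = -1 ∧ ε₂ = 1)

/-- The underlying vector space of `ℝ⁴_q`. -/
abbrev Space : Type := Fin 4 → ℝ

/-- The flat metric of index `q` on `ℝ⁴`. -/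
def metric (q : ℕ) (x y : Space) : ℝ :=
  ∑ i : Fin 4, (if (i : ℕ) < q then -1 else 1) * (x i * y i)

/-- A (positively oriented) Cartan frame `T, W₁, N, W₂` with curvatures `k₁, k₂` along a curve
`γ : I → ℝ⁴_q`. The covariant derivative along a curve in the flat space `ℝ⁴_q` is the usual
derivative. The equations `γ' = T`, `⟨T, T⟩ = 0` and `T' = a W₁` say that `γ` is null and
parametrized by the pseudo arc-length, `⟨γ'', γ''⟩ = ε₁ a²`; the third equation then gives the
linear independence of `γ', γ'', γ'''`. The orientation removes the ambiguity `W₂ ↦ -W₂`, so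
that the frame and the curvatures are determined on `I` by `γ`. -/
structure CartanFrame (bg : Background) (I : Set ℝ) (γ : ℝ → Space) where
  T : ℝ → Space
  W₁ : ℝ → Space
  N : ℝ → Space
  W₂ : ℝ → Space
  k₁ : ℝ → ℝ
  k₂ : ℝ → ℝ
  smooth_k₁ : ContDiffOn ℝ ∞ k₁ I
  smooth_k₂ : ContDiffOn ℝ ∞ k₂ I
  metric_TT : ∀ s ∈ I, metric bg.q (T s) (T s) = 0
  metric_NN : ∀ s ∈ I, metric bg.q (N s) (N s) = 0
  metric_TN : ∀ s ∈ I, metric bg.q (T s) (N s) = -1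
  metric_W₁T : ∀ s ∈ I, metric bg.q (W₁ s) (T s) = 0
  metric_W₁N : ∀ s ∈ I, metric bg.q (W₁ s) (N s) = 0
  metric_W₂T : ∀ s ∈ I, metric bg.q (W₂ s) (T s) = 0
  metric_W₂N : ∀ s ∈ I, metric bg.q (W₂ s) (N s) = 0
  metric_W₁W₂ : ∀ s ∈ I, metric bg.q (W₁ s) (W₂ s) = 0
  metric_W₁W₁ : ∀ s ∈ I, metric bg.q (W₁ s) (W₁ s) = bg.ε₁
  metric_W₂W₂ : ∀ s ∈ I, metric bg.q (W₂ s) (W₂ s) = bg.ε₂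
  oriented : ∀ s ∈ I, 0 < Matrix.det (Matrix.of ![T s, W₁ s, N s, W₂ s])
  deriv_γ : ∀ s ∈ I, HasDerivWithinAt γ (T s) I s
  deriv_T : ∀ s ∈ I, HasDerivWithinAt T (bg.a • W₁ s) I s
  deriv_W₁ : ∀ s ∈ I, HasDerivWithinAt W₁ (-k₁ s • T s + (bg.a * bg.ε₁) • N s) I s
  deriv_N : ∀ s ∈ I,
    HasDerivWithinAt N (-(bg.ε₁ * k₁ s) • W₁ s + (bg.ε₂ * k₂ s) • W₂ s) I s
  deriv_W₂ : ∀ s ∈ I, HasDerivWithinAt W₂ (k₂ s • T s) I s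

/-- The space `Λ` of smooth null curves `γ : I → ℝ⁴_q` that are parametrized by the pseudo
arc-length and carry a Cartan frame. A curve on `I` is represented by the function on `ℝ` that
vanishes off `I`. -/
structure NullCurve (bg : Background) (I : Set ℝ) where
  toFun : ℝ → Space
  eq_zero : ∀ s ∉ I, toFun s = 0
  smooth : ContDiffOn ℝ ∞ toFun I
  exists_frame : Nonempty (CartanFrame bg I toFun)

variable {bg : Background} {I : Set ℝ}

/-- The Cartan frame, with the curvatures, of a null curve in `Λ`. -/
def NullCurve.cartan (γ : NullCurve bg I) : CartanFrame bg I γ.toFun :=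
  Classical.choice γ.exists_frame

/-- The Cartan frame as a family, in the order `T, W₁, N, W₂`. -/
def NullCurve.frame (γ : NullCurve bg I) : Fin 4 → ℝ → Space :=
  ![γ.cartan.T, γ.cartan.W₁, γ.cartan.N, γ.cartan.W₂]

/-- The two curvatures as a family. -/
def NullCurve.curvature (γ : NullCurve bg I) : Fin 2 → ℝ → ℝ :=
  ![γ.cartan.k₁, γ.cartan.k₂]

/-! ### Differential polynomials in the curvatures -/

/-- The real algebra `𝒫 = ℝ[k₁^(m), k₂^(n) : m, n ∈ ℕ]` of differential polynomials in the two
curvatures: the generator `(0, m)` is `k₁^(m)`, the generator `(1, n)` is `k₂^(n)`. -/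
abbrev DiffPoly : Type := MvPolynomial (Fin 2 × ℕ) ℝ

/-- The derivative `f ↦ f'` of `𝒫`: the derivation with `(kᵢ^(m))' = kᵢ^(m+1)`. -/
def dσ : Derivation ℝ DiffPoly DiffPoly :=
  MvPolynomial.mkDerivation ℝ fun x => MvPolynomial.X (x.1, x.2 + 1)

/-- The first curvature as an element of `𝒫`. -/
def k₁ : DiffPoly := MvPolynomial.X (0, 0)

/-- The second curvature as an element of `𝒫`. -/
def k₂ : DiffPoly := MvPolynomial.X (1, 0)

/-- The function on `I` that a differential polynomial represents along `γ`. -/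
def NullCurve.eval (γ : NullCurve bg I) : DiffPoly →ₐ[ℝ] (ℝ → ℝ) :=
  MvPolynomial.aeval fun x => iteratedDerivWithin x.2 (γ.curvature x.1) I

/-! ### Local vector fields along a null curve -/

/-- A `𝒫`-local vector field `V = f T + h W₁ + g N + l W₂` along a null curve, given by its
components `V 0 = f`, `V 1 = h`, `V 2 = g`, `V 3 = l` in `𝒫`. -/
abbrev LocalField : Type := Fin 4 → DiffPoly

/-- The vector field along `γ` that a `𝒫`-local vector field represents. -/
def NullCurve.toField (γ : NullCurve bg I) (V : LocalField) (s : ℝ) : Space :=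
  ∑ i, γ.eval (V i) s • γ.frame i s

/-- The tangent field `T`. -/
def fieldT : LocalField := ![1, 0, 0, 0]

/-- The screen field `W₁`. -/
def fieldW₁ : LocalField := ![0, 1, 0, 0]

/-- The null transversal field `N`. -/
def fieldN : LocalField := ![0, 0, 1, 0]

/-- The screen field `W₂`. -/
def fieldW₂ : LocalField := ![0, 0, 0, 1]

/-- The metric on `𝒫`-local vector fields: `⟨T, N⟩ = -1`, `⟨Wᵢ, Wᵢ⟩ = εᵢ`, and all other
products of frame vectors vanish. -/
def pairing (bg : Background) (V U : LocalField) : DiffPoly :=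
  -(V 0 * U 2) - V 2 * U 0 + bg.ε₁ • (V 1 * U 1) + bg.ε₂ • (V 3 * U 3)

/-- The Cartan equations: row `i` holds the components of the covariant derivative along `T`
of the `i`-th vector of the frame `T, W₁, N, W₂`. -/
def cartanMatrix (bg : Background) : Matrix (Fin 4) (Fin 4) DiffPoly :=
  !![0, MvPolynomial.C bg.a, 0, 0;
     -k₁, 0, MvPolynomial.C (bg.a * bg.ε₁), 0;
     0, -(bg.ε₁ • k₁), 0, bg.ε₂ • k₂;
     k₂, 0, 0, 0]

/-- The covariant derivative `∇_T V` of a `𝒫`-local vector field. -/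
def nablaT (bg : Background) (V : LocalField) : LocalField :=
  fun j => dσ (V j) + ∑ i, V i * cartanMatrix bg i j

/-- `φ_V = ε₁ ⟨∇_T V, W₁⟩`. -/
def phi (bg : Background) (V : LocalField) : DiffPoly :=
  bg.ε₁ • pairing bg (nablaT bg V) fieldW₁

/-- `ψ_V = ε₂ ⟨∇_T V, W₂⟩`. -/
def psi (bg : Background) (V : LocalField) : DiffPoly :=
  bg.ε₂ • pairing bg (nablaT bg V) fieldW₂

/-- `ρ_V = -ε₁ ⟨∇_T² V, W₁⟩`. -/
def rho (bg : Background) (V : LocalField) : DiffPoly :=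
  -(bg.ε₁ • pairing bg (nablaT bg (nablaT bg V)) fieldW₁)

/-- `α_V = (φ_V' + ρ_V / 2) / a`. -/
def alpha (bg : Background) (V : LocalField) : DiffPoly :=
  (1 / bg.a) • (dσ (phi bg V) + (1 / 2 : ℝ) • rho bg V)

/-- `β_V = (α_V' + k₁ φ_V - k₂ ψ_V) / a`. -/
def beta (bg : Background) (V : LocalField) : DiffPoly :=
  (1 / bg.a) • (dσ (alpha bg V) + k₁ * phi bg V - k₂ * psi bg V)

/-- `δ_V = ψ_V'' / a + k₁ ψ_V + ε₁ ε₂ k₂ φ_V`. -/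
def delta (bg : Background) (V : LocalField) : DiffPoly :=
  (1 / bg.a) • dσ (dσ (psi bg V)) + k₁ * psi bg V + (bg.ε₁ * bg.ε₂) • (k₂ * phi bg V)

/-- The operator `θ(k₁) = D³ / a + k₁ D + D k₁`. -/
def theta (bg : Background) (f : DiffPoly) : DiffPoly :=
  (1 / bg.a) • dσ (dσ (dσ f)) + k₁ * dσ f + dσ (k₁ * f)

/-- The operator `S(k₂) = D k₂ + k₂ D`. -/
def opS (f : DiffPoly) : DiffPoly :=
  dσ (k₂ * f) + k₂ * dσ f

/-- The variations `V(k₁)` and `V(k₂)` of the curvatures in the direction `V`. -/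
def curvatureVariation (bg : Background) (V : LocalField) : Fin 2 → DiffPoly :=
  ![(1 / bg.a) • (theta bg (phi bg V) - opS (psi bg V))
      + (1 / bg.a) • ((1 / (2 * bg.a)) • dσ (dσ (rho bg V)) + k₁ * rho bg V),
    (1 / bg.a) • (opS (phi bg V) + (bg.ε₁ * bg.ε₂) • theta bg (psi bg V))
      + (1 / bg.a) • (k₂ * rho bg V)]

/-- The variations `V(kᵢ^(m))`, obtained from `V(kᵢ)` by the rule
`V(f') = V(f)' + ρ_V f' / (2a)`. -/
def jetVariation (bg : Background) (V : LocalField) (i : Fin 2) : ℕ → DiffPoly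
  | 0 => curvatureVariation bg V i
  | m + 1 => dσ (jetVariation bg V i m)
      + (1 / (2 * bg.a)) • (rho bg V * MvPolynomial.X (i, m + 1))

/-- The action `f ↦ V(f)` of a `𝒫`-local vector field on `𝒫`, a derivation. -/
def act (bg : Background) (V : LocalField) : Derivation ℝ DiffPoly DiffPoly :=
  MvPolynomial.mkDerivation ℝ fun x => jetVariation bg V x.1 x.2

/-- Row `i` holds the components of `D_V` of the `i`-th vector of the frame `T, W₁, N, W₂`. -/
def frameVariation (bg : Background) (V : LocalField) : Matrix (Fin 4) (Fin 4) DiffPoly :=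
  !![-alpha bg V, phi bg V, 0, psi bg V;
     -beta bg V, 0, bg.ε₁ • phi bg V, (1 / bg.a) • dσ (psi bg V);
     0, -(bg.ε₁ • beta bg V), alpha bg V, (bg.ε₁ / bg.a) • delta bg V;
     (bg.ε₁ * bg.ε₂ / bg.a) • delta bg V, -((bg.ε₁ * bg.ε₂ / bg.a) • dσ (psi bg V)),
       bg.ε₂ • psi bg V, 0]

/-- The tensor derivation `D_V` on `𝒫`-local vector fields: it acts on the components through
`f ↦ V(f)` and on the frame through `frameVariation`. -/
def tensorD (bg : Background) (V U : LocalField) : LocalField :=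
  fun j => act bg V (U j) + ∑ i, U i * frameVariation bg V i j

/-- The bracket `[V, U]_γ = D_V U - D_U V` of `𝒫`-local vector fields along a null curve. -/
def bracketAt (bg : Background) (V U : LocalField) : LocalField :=
  tensorD bg V U - tensorD bg U V

/-! ### Scalar fields and vector fields on the space of null curves -/

/-- The algebra `𝒜` of `𝒫`-valued scalar fields on `Λ`. -/
abbrev ScalarField (bg : Background) (I : Set ℝ) : Type := NullCurve bg I → DiffPoly

/-- The `𝒜`-local vector fields on `Λ`. -/
abbrev VectorField (bg : Background) (I : Set ℝ) : Type := NullCurve bg I → LocalField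

/-- A vector field on `Λ` acts on scalar fields curve by curve: `V(f)(γ) = V_γ(f_γ)`. -/
def VectorField.act (V : VectorField bg I) (f : ScalarField bg I) : ScalarField bg I :=
  fun γ => NullCurves.act bg (V γ) (f γ)

/-- The space `𝔛*_𝒜(Λ)` of the `𝒜`-local vector fields `f T + h W₁ + g N + l W₂` on `Λ` that
locally preserve the causal character, `h = -(ε₁ / a) g'`. -/
def causalFields (bg : Background) (I : Set ℝ) : Submodule ℝ (VectorField bg I) where
  carrier := {V | ∀ γ, V γ 1 = -((bg.ε₁ / bg.a) • dσ (V γ 2))}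
  zero_mem' := by intro γ; simp
  add_mem' := by
    intro V U hV hU γ
    simp only [Pi.add_apply, map_add, smul_add, neg_add]
    rw [hV γ, hU γ]
  smul_mem' := by
    intro c V hV γ
    simp only [Pi.smul_apply, Derivation.map_smul]
    rw [hV γ, smul_neg, smul_comm]

/-- The space `𝔛_𝒜(Λ)` of evolution vector fields: the members `f T + h W₁ + g N + l W₂` of
`𝔛*_𝒜(Λ)` that also locally preserve the pseudo arc-length parameter,
`f = ((ε₁ / a) g'' + D⁻¹(ε₁ k₁' g - a k₂ l)) / (2a)`, where `D⁻¹` is an indefinite integral: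
`p` is some antiderivative. -/
def evolutionFields (bg : Background) (I : Set ℝ) : Submodule ℝ (VectorField bg I) where
  carrier := {V | V ∈ causalFields bg I ∧ ∃ p : ScalarField bg I, ∀ γ,
    dσ (p γ) = bg.ε₁ • (dσ k₁ * V γ 2) - bg.a • (k₂ * V γ 3) ∧
    V γ 0 = (1 / (2 * bg.a)) • ((bg.ε₁ / bg.a) • dσ (dσ (V γ 2)) + p γ)}
  zero_mem' := ⟨Submodule.zero_mem _, 0, fun γ => by simp⟩
  add_mem' := by
    rintro V U ⟨hV, p, hp⟩ ⟨hU, r, hr⟩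
    refine ⟨Submodule.add_mem _ hV hU, p + r, fun γ => ⟨?_, ?_⟩⟩
    · simp only [Pi.add_apply, map_add, mul_add, smul_add]
      rw [(hp γ).1, (hr γ).1]
      abel
    · simp only [Pi.add_apply, map_add, smul_add]
      rw [(hp γ).2, (hr γ).2]
      simp only [smul_add]
      abel
  smul_mem' := by
    rintro c V ⟨hV, p, hp⟩
    refine ⟨Submodule.smul_mem _ c hV, c • p, fun γ => ⟨?_, ?_⟩⟩
    · simp only [Pi.smul_apply, Derivation.map_smul, mul_smul_comm]
      rw [(hp γ).1, smul_sub, smul_comm c, smul_comm c]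
    · simp only [Pi.smul_apply, Derivation.map_smul]
      rw [(hp γ).2, smul_comm c, smul_add, smul_comm c]

/-! ### The definitions agree with their characterizations -/

/-- The rule for `V(f')` holds on all of `𝒫`. -/
theorem act_dσ (bg : Background) (V : LocalField) (f : DiffPoly) :
    act bg V (dσ f) = dσ (act bg V f) + (1 / (2 * bg.a)) • (rho bg V * dσ f) := by
  induction f using MvPolynomial.induction_on with
  | C r => simp [MvPolynomial.derivation_C]
  | add p r hp hr => simp only [map_add, hp, hr, mul_add, smul_add]; abel
  | mul_X p x hp =>
    have hX : act bg V (dσ (MvPolynomial.X x)) = dσ (act bg V (MvPolynomial.X x))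
        + (1 / (2 * bg.a)) • (rho bg V * dσ (MvPolynomial.X x)) := by
      simp [act, dσ, jetVariation]
    simp only [Derivation.leibniz, map_add, smul_eq_mul, hp, hX, MvPolynomial.smul_eq_C_mul]
    ring

/-- `f ↦ V(f)` is the only derivation with the prescribed values on the curvatures and the
prescribed rule for `V(f')`. -/
theorem act_unique (bg : Background) (V : LocalField) (ξ : Derivation ℝ DiffPoly DiffPoly)
    (h : ∀ f, ξ (dσ f) = dσ (ξ f) + (1 / (2 * bg.a)) • (rho bg V * dσ f))
    (h₁ : ξ k₁ = curvatureVariation bg V 0) (h₂ : ξ k₂ = curvatureVariation bg V 1) :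
    ξ = act bg V := by
  apply MvPolynomial.derivation_ext
  rintro ⟨i, m⟩
  induction m with
  | zero => fin_cases i <;> simpa [act, jetVariation, k₁, k₂] using ‹_›
  | succ m ih =>
    have hd : dσ (MvPolynomial.X (i, m)) = MvPolynomial.X (i, m + 1) := by simp [dσ]
    rw [← hd, h, act_dσ, ih]

/-- The derivative of `𝒫` represents the derivative along `γ`. -/
theorem NullCurve.hasDerivWithinAt_eval (γ : NullCurve bg I) (hI : UniqueDiffOn ℝ I)
    (f : DiffPoly) {s : ℝ} (hs : s ∈ I) :
    HasDerivWithinAt (γ.eval f) (γ.eval (dσ f) s) I s := by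
  induction f using MvPolynomial.induction_on with
  | C r =>
    have h0 : γ.eval (MvPolynomial.C r) = fun _ => r := by
      funext t; simp [NullCurve.eval]
    rw [h0]
    simpa [MvPolynomial.derivation_C] using hasDerivWithinAt_const s I r
  | add p r hp hr =>
    simpa using hp.add hr
  | mul_X p x hp =>
    have hk : ContDiffOn ℝ ∞ (γ.curvature x.1) I := by
      obtain ⟨i, m⟩ := x
      fin_cases i
      · exact γ.cartan.smooth_k₁
      · exact γ.cartan.smooth_k₂
    have hX : HasDerivWithinAt (γ.eval (MvPolynomial.X x))
        (γ.eval (dσ (MvPolynomial.X x)) s) I s := by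
      have hd : DifferentiableWithinAt ℝ (iteratedDerivWithin x.2 (γ.curvature x.1) I) I s :=
        hk.differentiableOn_iteratedDerivWithin (by exact_mod_cast WithTop.coe_lt_top _) hI s hs
      simpa [NullCurve.eval, dσ, iteratedDerivWithin_succ] using hd.hasDerivWithinAt
    rw [map_mul]
    refine (hp.mul hX).congr_deriv ?_
    simp only [map_mul, Derivation.leibniz, map_add, smul_eq_mul, Pi.add_apply, Pi.mul_apply]
    ring

/-- `nablaT` represents the covariant derivative along `γ`. -/
theorem NullCurve.hasDerivWithinAt_toField (γ : NullCurve bg I) (hI : UniqueDiffOn ℝ I)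
    (V : LocalField) {s : ℝ} (hs : s ∈ I) :
    HasDerivWithinAt (γ.toField V) (γ.toField (nablaT bg V) s) I s := by
  have hk₁ : γ.eval k₁ s = γ.cartan.k₁ s := by simp [NullCurve.eval, k₁, NullCurve.curvature]
  have hk₂ : γ.eval k₂ s = γ.cartan.k₂ s := by simp [NullCurve.eval, k₂, NullCurve.curvature]
  have e := fun i => γ.hasDerivWithinAt_eval hI (V i) hs
  have h0 := (e 0).smul (γ.cartan.deriv_T s hs)
  have h1 := (e 1).smul (γ.cartan.deriv_W₁ s hs)
  have h2 := (e 2).smul (γ.cartan.deriv_N s hs)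
  have h3 := (e 3).smul (γ.cartan.deriv_W₂ s hs)
  have h := ((h0.add h1).add h2).add h3
  have hf : γ.toField V = γ.eval (V 0) • γ.cartan.T + γ.eval (V 1) • γ.cartan.W₁
      + γ.eval (V 2) • γ.cartan.N + γ.eval (V 3) • γ.cartan.W₂ := by
    funext t
    simp [NullCurve.toField, NullCurve.frame, Fin.sum_univ_four]
  rw [hf]
  refine h.congr_deriv ?_
  simp only [NullCurve.toField, nablaT, cartanMatrix, NullCurve.frame, Fin.sum_univ_four]
  simp [hk₁, hk₂]
  module

/-- `pairing` represents the metric along `γ`. -/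
theorem NullCurve.eval_pairing (γ : NullCurve bg I) (V U : LocalField) {s : ℝ} (hs : s ∈ I) :
    γ.eval (pairing bg V U) s = metric bg.q (γ.toField V s) (γ.toField U s) := by
  have hadd : ∀ x y z, metric bg.q (x + y) z = metric bg.q x z + metric bg.q y z := by
    intro x y z; simp only [metric, Fin.sum_univ_four, Pi.add_apply]; ring
  have hsmul : ∀ (c : ℝ) x z, metric bg.q (c • x) z = c * metric bg.q x z := by
    intro c x z; simp only [metric, Fin.sum_univ_four, Pi.smul_apply, smul_eq_mul]; ring
  have hcomm : ∀ x y, metric bg.q x y = metric bg.q y x := by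
    intro x y; simp only [metric, mul_comm]
  have hadd' : ∀ x y z, metric bg.q z (x + y) = metric bg.q z x + metric bg.q z y := by
    intro x y z; rw [hcomm, hadd, hcomm x, hcomm y]
  have hsmul' : ∀ (c : ℝ) x z, metric bg.q z (c • x) = c * metric bg.q z x := by
    intro c x z; rw [hcomm, hsmul, hcomm x]
  simp only [NullCurve.toField, NullCurve.frame, Fin.sum_univ_four, Matrix.cons_val,
    hadd, hadd', hsmul, hsmul', γ.cartan.metric_TT s hs, γ.cartan.metric_NN s hs,
    γ.cartan.metric_TN s hs, γ.cartan.metric_W₁T s hs, γ.cartan.metric_W₁N s hs,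
    γ.cartan.metric_W₂T s hs, γ.cartan.metric_W₂N s hs, γ.cartan.metric_W₁W₂ s hs,
    γ.cartan.metric_W₁W₁ s hs, γ.cartan.metric_W₂W₂ s hs,
    hcomm (γ.cartan.T s) (γ.cartan.W₁ s), hcomm (γ.cartan.T s) (γ.cartan.W₂ s),
    hcomm (γ.cartan.N s) (γ.cartan.T s), hcomm (γ.cartan.N s) (γ.cartan.W₁ s),
    hcomm (γ.cartan.N s) (γ.cartan.W₂ s), hcomm (γ.cartan.W₂ s) (γ.cartan.W₁ s)]
  simp [pairing]
  ring

theorem Background.ε₁_sq (bg : Background) : bg.ε₁ * bg.ε₁ = 1 := by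
  rcases bg.signs with h | h | h <;> simp [h.2.1]

/-- The members of `𝔛*_𝒜(Λ)` are the `𝒜`-local vector fields with `⟨∇_T V, T⟩ = 0`. -/
theorem mem_causalFields_iff (V : VectorField bg I) :
    V ∈ causalFields bg I ↔ ∀ γ, pairing bg (nablaT bg (V γ)) fieldT = 0 := by
  refine forall_congr' fun γ => ?_
  have ha := bg.a_pos.ne'
  have he := bg.ε₁_sq
  have h0 : pairing bg (nablaT bg (V γ)) fieldT
      = -(dσ (V γ 2) + (bg.a * bg.ε₁) • V γ 1) := by
    simp [pairing, fieldT, nablaT, cartanMatrix, Fin.sum_univ_four, MvPolynomial.smul_eq_C_mul]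
    ring
  rw [h0]
  constructor
  · intro h
    rw [h, smul_neg, smul_smul]
    have : bg.a * bg.ε₁ * (bg.ε₁ / bg.a) = 1 := by field_simp; linarith
    rw [this, one_smul, add_neg_cancel, neg_zero]
  · intro h
    have h1 : dσ (V γ 2) = -((bg.a * bg.ε₁) • V γ 1) := by
      rw [neg_eq_zero] at h
      exact eq_neg_of_add_eq_zero_left h
    have : bg.ε₁ / bg.a * (bg.a * bg.ε₁) = 1 := by field_simp; linarith
    rw [h1, smul_neg, neg_neg, smul_smul, this, one_smul]

/-- The members of `𝔛_𝒜(Λ)` are the members of `𝔛*_𝒜(Λ)` with `⟨∇_T² V, W₁⟩ = 0`, that is,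
`ρ_V = 0`. -/
theorem mem_evolutionFields_iff (V : VectorField bg I) :
    V ∈ evolutionFields bg I ↔ V ∈ causalFields bg I ∧ ∀ γ, rho bg (V γ) = 0 := by
  have ha := bg.a_pos.ne'
  have he := bg.ε₁_sq
  refine and_congr_right fun hV => ?_
  have key : ∀ γ, rho bg (V γ) = bg.ε₁ • (dσ k₁ * V γ 2) - bg.a • (k₂ * V γ 3)
      + (bg.ε₁ / bg.a) • dσ (dσ (dσ (V γ 2))) - (2 * bg.a) • dσ (V γ 0) := by
    intro γ
    have hγ := hV γ
    have hC : ∀ r, dσ (MvPolynomial.C r) = 0 := fun r => MvPolynomial.derivation_C _ r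
    simp only [rho, pairing, fieldW₁, nablaT, cartanMatrix, Fin.sum_univ_four, hγ]
    simp [MvPolynomial.smul_eq_C_mul, hC]
    have h1 : (MvPolynomial.C bg.ε₁ : DiffPoly) * MvPolynomial.C bg.ε₁ = 1 := by
      rw [← MvPolynomial.C_mul, he, MvPolynomial.C_1]
    have h2 : (MvPolynomial.C bg.a : DiffPoly) * MvPolynomial.C (bg.ε₁ / bg.a)
        = MvPolynomial.C bg.ε₁ := by
      rw [← MvPolynomial.C_mul, mul_div_cancel₀ _ ha]
    generalize (MvPolynomial.C (bg.ε₁ / bg.a) : DiffPoly) = c at *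
    generalize (MvPolynomial.C bg.ε₁ : DiffPoly) = e at *
    generalize (MvPolynomial.C bg.a : DiffPoly) = a at *
    have h3 : (MvPolynomial.C 2 : DiffPoly) = 2 := rfl
    rw [h3]
    linear_combination (e * k₁ * (dσ (V γ 2) - c * a * e * dσ (V γ 2)) - a * dσ (V γ 0)
      - a * c * dσ (V γ 2) * k₁ - a * V γ 3 * k₂ + e * V γ 2 * dσ k₁ + e * k₁ * dσ (V γ 2)
      - a * dσ (V γ 0) + c * dσ (dσ (dσ (V γ 2))) - e * k₁ * dσ (V γ 2)) * h1
      - (e * e * k₁ * dσ (V γ 2) + k₁ * dσ (V γ 2)) * h2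
  simp only [key]
  constructor
  · rintro ⟨p, hp⟩ γ
    obtain ⟨h1, h2⟩ := hp γ
    have : (2 * bg.a) • dσ (V γ 0) = (bg.ε₁ / bg.a) • dσ (dσ (dσ (V γ 2))) + dσ (p γ) := by
      rw [h2]
      simp only [Derivation.map_smul, map_add, smul_smul]
      rw [mul_one_div_cancel (by positivity), one_smul]
    rw [this, h1]
    abel
  · intro h
    refine ⟨fun γ => (2 * bg.a) • V γ 0 - (bg.ε₁ / bg.a) • dσ (dσ (V γ 2)), fun γ => ⟨?_, ?_⟩⟩
    · have := h γ
      simp only [Derivation.map_smul, map_sub]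
      rw [sub_eq_zero] at this
      rw [← this]
      abel
    · rw [add_sub_cancel, smul_smul, one_div_mul_cancel (by positivity), one_smul]

end NullCurves

end

noncomputable section

namespace NullCurves

open MvPolynomial (C)

variable {bg : Background} {I : Set ℝ}

/-! Everything follows once `D_[V,U] = [D_V, D_U]` and `[V,U](f) = V(U f) - U(V f)` hold for causal
`V`, `U`. The direct check is a large polynomial identity; a rigidity argument avoids it. Three
facts about `D_V` are needed. It commutes with `∇_T` up to the factor `ρ_V / (2a)`
(`tensorD_nablaT`), which is the compatibility of the frame variation with the Cartan equations
(`act_cartanMatrix`). It respects the metric (`pairing_tensorD`). For causal `V` it satisfies the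
torsion identity `D_V T = ∇_T V + (ρ_V / (2a)) T` (`IsCausal.tensorD_fieldT`). Hence the defect `E =
[D_V, D_U] - D_[V,U]` is a skew tensor derivation that commutes with `∇_T` up to a function `c`, and
`E T = c T`. Since `T` generates the frame through the Cartan equations and the metric, `c`, the
action on the curvatures and then `E` all vanish (`defect_eq_zero`). The Jacobi identity and (a) are
then formal. For (b), evolution fields are the causal fields with `ρ = 0`, and `c = 0` says that `ρ
/ (2a)` is a cocycle, so its kernel is closed under the bracket. -/

theorem Background.ε₂_sq (bg : Background) : bg.ε₂ * bg.ε₂ = 1 := by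
  rcases bg.signs with h | h | h <;> simp [h.2.2]

/-! ### The connection and its variation -/

/-- `φ_V` is the `W₁`-component of `∇_T V`. -/
theorem phi_eq (V : LocalField) : phi bg V = nablaT bg V 1 := by
  simp [phi, pairing, fieldW₁, smul_smul, bg.ε₁_sq]

/-- `ψ_V` is the `W₂`-component of `∇_T V`. -/
theorem psi_eq (V : LocalField) : psi bg V = nablaT bg V 3 := by
  simp [psi, pairing, fieldW₂, smul_smul, bg.ε₂_sq]

/-- `ρ_V` is minus the `W₁`-component of `∇_T² V`. -/
theorem rho_eq (V : LocalField) : rho bg V = -nablaT bg (nablaT bg V) 1 := by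
  simp [rho, pairing, fieldW₁, smul_smul, bg.ε₁_sq]

theorem dσ_C (r : ℝ) : dσ (C r) = 0 := MvPolynomial.derivation_C _ r

theorem act_k₁ (V : LocalField) : act bg V k₁ = curvatureVariation bg V 0 := by
  simp [act, k₁, jetVariation]

theorem act_k₂ (V : LocalField) : act bg V k₂ = curvatureVariation bg V 1 := by
  simp [act, k₂, jetVariation]

/-- The definitions of `α`, `β`, `δ` solved for the highest derivative; these relations serve as
rewriting rules in `act_cartanMatrix`. -/
theorem dσ_phi (V : LocalField) :
    dσ (phi bg V) = bg.a • alpha bg V - (1 / 2 : ℝ) • rho bg V := by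
  rw [alpha, smul_smul, mul_one_div_cancel bg.a_pos.ne', one_smul, add_sub_cancel_right]

theorem dσ_alpha (V : LocalField) :
    dσ (alpha bg V) = bg.a • beta bg V - k₁ * phi bg V + k₂ * psi bg V := by
  rw [beta, smul_smul, mul_one_div_cancel bg.a_pos.ne', one_smul]
  ring

theorem dσ_dσ_psi (V : LocalField) :
    dσ (dσ (psi bg V)) = bg.a • (delta bg V - k₁ * psi bg V
      - (bg.ε₁ * bg.ε₂) • (k₂ * phi bg V)) := by
  have h : delta bg V - k₁ * psi bg V - (bg.ε₁ * bg.ε₂) • (k₂ * phi bg V)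
      = (1 / bg.a) • dσ (dσ (psi bg V)) := by
    rw [delta]; abel
  rw [h, smul_smul, mul_one_div_cancel bg.a_pos.ne', one_smul]

/-- This is the form of `V(k₁)` demanded by the `T`-component of the varied equation for `W₁'`;
likewise `act_k₂_eq` for `W₂'`. -/
theorem act_k₁_eq (V : LocalField) :
    act bg V k₁ = dσ (beta bg V) + k₁ * alpha bg V - (1 / bg.a) • (k₂ * dσ (psi bg V))
      + (1 / (2 * bg.a)) • (rho bg V * k₁) := by
  have h2 : (C (1 / (2 * bg.a)) : DiffPoly) = C (1 / 2) * C (1 / bg.a) := by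
    rw [← MvPolynomial.C_mul]; congr 1; field_simp
  have h3 : (2 : DiffPoly) * C (1 / 2) = 1 := by
    rw [show (2 : DiffPoly) = C 2 from rfl, ← MvPolynomial.C_mul]; norm_num
  rw [act_k₁]
  simp only [curvatureVariation, theta, opS, Matrix.cons_val_zero, beta, alpha,
    MvPolynomial.smul_eq_C_mul, h2, map_add, map_sub, Derivation.leibniz, smul_eq_mul, dσ_C,
    mul_zero, add_zero]
  linear_combination (-C (1 / bg.a) * k₁ * rho bg V) * h3

theorem act_k₂_eq (V : LocalField) :
    act bg V k₂ = (bg.ε₁ * bg.ε₂ / bg.a) • (dσ (delta bg V) + k₁ * dσ (psi bg V))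
      + k₂ * alpha bg V + (1 / (2 * bg.a)) • (rho bg V * k₂) := by
  have h2 : (C (1 / (2 * bg.a)) : DiffPoly) = C (1 / 2) * C (1 / bg.a) := by
    rw [← MvPolynomial.C_mul]; congr 1; field_simp
  have h3 : (2 : DiffPoly) * C (1 / 2) = 1 := by
    rw [show (2 : DiffPoly) = C 2 from rfl, ← MvPolynomial.C_mul]; norm_num
  have h4 : (C (bg.ε₁ * bg.ε₂ / bg.a) : DiffPoly) = C (bg.ε₁ * bg.ε₂) * C (1 / bg.a) := by
    rw [← MvPolynomial.C_mul]; congr 1; ring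
  have h5 : (C (bg.ε₁ * bg.ε₂) : DiffPoly) * C (bg.ε₁ * bg.ε₂) = 1 := by
    rw [← MvPolynomial.C_mul, mul_mul_mul_comm, bg.ε₁_sq, bg.ε₂_sq, one_mul, MvPolynomial.C_1]
  rw [act_k₂]
  simp only [curvatureVariation, theta, opS, Matrix.cons_val_one, Matrix.cons_val_zero, delta,
    alpha, MvPolynomial.smul_eq_C_mul, h2, h4, map_add, Derivation.leibniz, smul_eq_mul, dσ_C,
    mul_zero, add_zero]
  linear_combination (-C (1 / bg.a) * k₂ * rho bg V) * h3
    - (C (1 / bg.a) * (k₂ * dσ (phi bg V) + phi bg V * dσ k₂)) * h5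

/-- The variation of the frame is compatible with the Cartan equations. -/
theorem act_cartanMatrix (V : LocalField) (i j : Fin 4) :
    act bg V (cartanMatrix bg i j)
        + ∑ l, cartanMatrix bg i l * frameVariation bg V l j
      = dσ (frameVariation bg V i j)
        + ∑ l, frameVariation bg V i l * cartanMatrix bg l j
        + C (1 / (2 * bg.a)) * (rho bg V * cartanMatrix bg i j) := by
  have h1 : (C bg.a : DiffPoly) * C (1 / bg.a) = 1 := by
    rw [← MvPolynomial.C_mul, mul_one_div_cancel bg.a_pos.ne', MvPolynomial.C_1]
  have h2 : (C (1 / (2 * bg.a)) : DiffPoly) = C (1 / 2) * C (1 / bg.a) := by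
    rw [← MvPolynomial.C_mul]; congr 1; field_simp
  have hφ := dσ_phi (bg := bg) V
  have hα := dσ_alpha (bg := bg) V
  have hψ := dσ_dσ_psi (bg := bg) V
  have e1 := act_k₁_eq (bg := bg) V
  have e2 := act_k₂_eq (bg := bg) V
  have s1 : (C bg.ε₁ : DiffPoly) * C bg.ε₁ = 1 := by
    rw [← MvPolynomial.C_mul, bg.ε₁_sq, MvPolynomial.C_1]
  have s2 : (C bg.ε₂ : DiffPoly) * C bg.ε₂ = 1 := by
    rw [← MvPolynomial.C_mul, bg.ε₂_sq, MvPolynomial.C_1]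
  have c1 : (C (bg.ε₁ / bg.a) : DiffPoly) = C bg.ε₁ * C (1 / bg.a) := by
    rw [← MvPolynomial.C_mul]; congr 1; ring
  have c2 : (C (bg.ε₁ * bg.ε₂ / bg.a) : DiffPoly) = C bg.ε₁ * C bg.ε₂ * C (1 / bg.a) := by
    rw [← MvPolynomial.C_mul, ← MvPolynomial.C_mul]; congr 1; ring
  simp only [MvPolynomial.smul_eq_C_mul, h2, c2, MvPolynomial.C_mul]
    at hφ hα hψ e1 e2
  -- Each entry is either immediate or one of the five relations for `φ'`, `α'`, `ψ''`, `V(k₁)`,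
  -- `V(k₂)`, up to signs with square one.
  fin_cases i <;> fin_cases j <;>
  simp [cartanMatrix, frameVariation, Fin.sum_univ_four, MvPolynomial.smul_eq_C_mul,
    Derivation.leibniz, -one_div, c1, c2, h2] <;>
  grind

/-! ### Leibniz rules, commutation with `∇_T`, and the metric -/

theorem tensorD_add (V X Y : LocalField) :
    tensorD bg V (X + Y) = tensorD bg V X + tensorD bg V Y := by
  funext j
  simp only [tensorD, Pi.add_apply, map_add, add_mul, Finset.sum_add_distrib]
  ring

theorem tensorD_smul (V : LocalField) (f : DiffPoly) (X : LocalField) :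
    tensorD bg V (f • X) = act bg V f • X + f • tensorD bg V X := by
  funext j
  simp only [tensorD, Pi.add_apply, Pi.smul_apply, Derivation.leibniz, smul_eq_mul, mul_assoc,
    ← Finset.mul_sum]
  ring

theorem nablaT_add (X Y : LocalField) :
    nablaT bg (X + Y) = nablaT bg X + nablaT bg Y := by
  funext j
  simp only [nablaT, Pi.add_apply, map_add, add_mul, Finset.sum_add_distrib]
  ring

theorem nablaT_smul (f : DiffPoly) (X : LocalField) :
    nablaT bg (f • X) = dσ f • X + f • nablaT bg X := by
  funext j
  simp only [nablaT, Pi.add_apply, Pi.smul_apply, Derivation.leibniz, smul_eq_mul, mul_assoc,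
    ← Finset.mul_sum]
  ring

theorem nablaT_neg (X : LocalField) : nablaT bg (-X) = -nablaT bg X := by
  funext j
  simp only [nablaT, Pi.neg_apply, map_neg, neg_mul, Finset.sum_neg_distrib]
  ring

theorem nablaT_sub (X Y : LocalField) :
    nablaT bg (X - Y) = nablaT bg X - nablaT bg Y := by
  rw [sub_eq_add_neg, nablaT_add, nablaT_neg, ← sub_eq_add_neg]

theorem tensorD_neg (V X : LocalField) : tensorD bg V (-X) = -tensorD bg V X := by
  funext j
  simp only [tensorD, Pi.neg_apply, map_neg, neg_mul, Finset.sum_neg_distrib]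
  ring

theorem tensorD_sub (V X Y : LocalField) :
    tensorD bg V (X - Y) = tensorD bg V X - tensorD bg V Y := by
  rw [sub_eq_add_neg, tensorD_add, tensorD_neg, ← sub_eq_add_neg]

/-- The rate `ρ_V / (2a)` at which `V` changes the pseudo arc-length. -/
def rate (bg : Background) (V : LocalField) : DiffPoly := C (1 / (2 * bg.a)) * rho bg V

theorem act_dσ_rate (V : LocalField) (f : DiffPoly) :
    act bg V (dσ f) = dσ (act bg V f) + rate bg V * dσ f := by
  rw [act_dσ, rate, MvPolynomial.smul_eq_C_mul, mul_assoc]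

/-- The commutation rule of `D_V` and `∇_T`. -/
theorem tensorD_nablaT (V U : LocalField) :
    tensorD bg V (nablaT bg U) = nablaT bg (tensorD bg V U) + rate bg V • nablaT bg U := by
  funext j
  have h := fun i => act_cartanMatrix (bg := bg) V i j
  simp only [tensorD, nablaT, Pi.add_apply, Pi.smul_apply, smul_eq_mul, map_add, act_dσ_rate,
    Fin.sum_univ_four, Derivation.leibniz] at h ⊢
  simp only [rate] at *
  linear_combination U 0 * h 0 + U 1 * h 1 + U 2 * h 2 + U 3 * h 3

/-- The matrix `frameVariation` is skew for the constant Gram matrix of the frame. -/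
theorem pairing_tensorD (V X Y : LocalField) :
    act bg V (pairing bg X Y) = pairing bg (tensorD bg V X) Y + pairing bg X (tensorD bg V Y) := by
  have s1 : (C bg.ε₁ : DiffPoly) * C bg.ε₁ = 1 := by
    rw [← MvPolynomial.C_mul, bg.ε₁_sq, MvPolynomial.C_1]
  have s2 : (C bg.ε₂ : DiffPoly) * C bg.ε₂ = 1 := by
    rw [← MvPolynomial.C_mul, bg.ε₂_sq, MvPolynomial.C_1]
  have c1 : (C (bg.ε₁ / bg.a) : DiffPoly) = C bg.ε₁ * C (1 / bg.a) := by
    rw [← MvPolynomial.C_mul]; congr 1; ring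
  have c2 : (C (bg.ε₁ * bg.ε₂ / bg.a) : DiffPoly) = C bg.ε₁ * C bg.ε₂ * C (1 / bg.a) := by
    rw [← MvPolynomial.C_mul, ← MvPolynomial.C_mul]; congr 1; ring
  simp [pairing, tensorD, frameVariation, Fin.sum_univ_four, MvPolynomial.smul_eq_C_mul, Derivation.leibniz, -one_div, c1, c2]
  grind

/-! ### Causal fields and the torsion identity -/

/-- A `𝒫`-local vector field preserves the causal character when `∇_T V` is orthogonal to `T`. -/
def IsCausal (bg : Background) (V : LocalField) : Prop := nablaT bg V 2 = 0

theorem pairing_fieldT (X : LocalField) : pairing bg X fieldT = -X 2 := by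
  simp [pairing, fieldT]

theorem mem_causalFields (V : VectorField bg I) :
    V ∈ causalFields bg I ↔ ∀ γ, IsCausal bg (V γ) := by
  simp only [mem_causalFields_iff, pairing_fieldT, neg_eq_zero, IsCausal]

/-- Torsion-freeness up to the change of parameter. Causality supplies the vanishing `N`-component
and, through `ρ_V`, the value of `α_V`. -/
theorem IsCausal.tensorD_fieldT {V : LocalField} (hV : IsCausal bg V) :
    tensorD bg V fieldT = nablaT bg V + rate bg V • fieldT := by
  have h1 : (C bg.a : DiffPoly) * C (1 / bg.a) = 1 := by
    rw [← MvPolynomial.C_mul, mul_one_div_cancel bg.a_pos.ne', MvPolynomial.C_1]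
  have h2 : (C (1 / (2 * bg.a)) : DiffPoly) = C (1 / 2) * C (1 / bg.a) := by
    rw [← MvPolynomial.C_mul]; congr 1; field_simp
  have h3 : (2 : DiffPoly) * C (1 / 2) = 1 := by
    rw [show (2 : DiffPoly) = C 2 from rfl, ← MvPolynomial.C_mul]; norm_num
  have hz : nablaT bg V 2 = 0 := hV
  -- As `∇_T V` has no `N`-component, only `φ_V` and its `T`-component contribute to the
  -- `W₁`-component of `∇_T² V`.
  have hρ : rho bg V = -(dσ (phi bg V) + C bg.a * nablaT bg V 0) := by
    rw [rho_eq, nablaT, phi_eq]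
    simp only [Fin.sum_univ_four, hz]
    simp [cartanMatrix, mul_comm]
  have hp := phi_eq (bg := bg) V
  have hq := psi_eq (bg := bg) V
  funext j
  fin_cases j
  · simp [tensorD, fieldT, frameVariation, Fin.sum_univ_four, rate, h2, alpha,
      MvPolynomial.smul_eq_C_mul, -one_div]
    grind
  all_goals simp [tensorD, fieldT, frameVariation, Fin.sum_univ_four, hp, hq, hz]

/-- Applying `D_V` to `⟨∇_T U, T⟩ = 0` gives `⟨∇_T D_V U, T⟩ = -⟨∇_T U, ∇_T V⟩`, which is symmetric
in `V` and `U` and so cancels in the bracket. -/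
theorem IsCausal.bracketAt {V U : LocalField} (hV : IsCausal bg V) (hU : IsCausal bg U) :
    IsCausal bg (bracketAt bg V U) := by
  have hcomm : ∀ X Y, pairing bg X Y = pairing bg Y X := fun X Y => by
    simp only [pairing, mul_comm]; abel
  have key : ∀ X Y, IsCausal bg X → IsCausal bg Y →
      pairing bg (nablaT bg (tensorD bg X Y)) fieldT = -pairing bg (nablaT bg Y) (nablaT bg X) := by
    intro X Y (hX : nablaT bg X 2 = 0) (hY : nablaT bg Y 2 = 0)
    have h1 : pairing bg (nablaT bg Y) fieldT = 0 := by rw [pairing_fieldT, hY, neg_zero]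
    have h2 := pairing_tensorD (bg := bg) X (nablaT bg Y) fieldT
    rw [h1, map_zero, tensorD_nablaT, IsCausal.tensorD_fieldT hX] at h2
    simp [pairing, fieldT, hX, hY] at h2 ⊢
    linear_combination -h2
  have h := key V U hV hU
  have h' := key U V hU hV
  rw [pairing_fieldT] at h h'
  have e := hcomm (nablaT bg U) (nablaT bg V)
  rw [IsCausal, NullCurves.bracketAt, nablaT_sub, Pi.sub_apply]
  linear_combination h' - h + e

/-! ### Formal properties of the defects -/

/-- The defect of `V ↦ act V` as a Lie algebra morphism. -/
def actDefect (bg : Background) (V U : LocalField) : Derivation ℝ DiffPoly DiffPoly :=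
  ⁅act bg V, act bg U⁆ - act bg (bracketAt bg V U)

/-- The defect of `V ↦ D_V` as a Lie algebra morphism. -/
def tensorDefect (bg : Background) (V U X : LocalField) : LocalField :=
  tensorD bg V (tensorD bg U X) - tensorD bg U (tensorD bg V X) - tensorD bg (bracketAt bg V U) X

/-- The defect of `V ↦ ρ_V / (2a)` as a cocycle. -/
def rateDefect (bg : Background) (V U : LocalField) : DiffPoly :=
  act bg V (rate bg U) - act bg U (rate bg V) - rate bg (bracketAt bg V U)

theorem actDefect_apply (V U : LocalField) (f : DiffPoly) :
    actDefect bg V U f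
      = act bg V (act bg U f) - act bg U (act bg V f) - act bg (bracketAt bg V U) f := by
  simp [actDefect, Derivation.commutator_apply]

theorem tensorDefect_add (V U X Y : LocalField) :
    tensorDefect bg V U (X + Y) = tensorDefect bg V U X + tensorDefect bg V U Y := by
  simp only [tensorDefect, tensorD_add]; abel

/-- The mixed terms `V(f) D_U X` cancel in the commutator. -/
theorem tensorDefect_smul (V U : LocalField) (f : DiffPoly) (X : LocalField) :
    tensorDefect bg V U (f • X) = actDefect bg V U f • X + f • tensorDefect bg V U X := by
  simp only [tensorDefect, tensorD_add, tensorD_smul, actDefect_apply]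
  module

/-- The terms in which a rate multiplies a first variation, and the product of the two rates, are
symmetric in `V` and `U`; only derivatives of the rates survive. The same holds in
`tensorDefect_nablaT`. -/
theorem actDefect_dσ (V U : LocalField) (f : DiffPoly) :
    actDefect bg V U (dσ f) = dσ (actDefect bg V U f) + rateDefect bg V U * dσ f := by
  simp only [actDefect_apply, act_dσ_rate, map_add, map_sub, Derivation.leibniz, smul_eq_mul,
    rateDefect]
  ring

theorem tensorDefect_nablaT (V U X : LocalField) :
    tensorDefect bg V U (nablaT bg X)
      = nablaT bg (tensorDefect bg V U X) + rateDefect bg V U • nablaT bg X := by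
  simp only [tensorDefect, tensorD_nablaT, tensorD_add, tensorD_smul, nablaT_sub, rateDefect]
  module

theorem pairing_tensorDefect (V U X Y : LocalField) :
    actDefect bg V U (pairing bg X Y)
      = pairing bg (tensorDefect bg V U X) Y + pairing bg X (tensorDefect bg V U Y) := by
  simp only [actDefect_apply, pairing_tensorD, map_add]
  simp only [tensorDefect, pairing, Pi.sub_apply, MvPolynomial.smul_eq_C_mul]
  ring

/-- The torsion identity is used for `V`, for `U`, and for the bracket, which is causal as well. -/
theorem tensorDefect_fieldT {V U : LocalField} (hV : IsCausal bg V) (hU : IsCausal bg U) :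
    tensorDefect bg V U fieldT = rateDefect bg V U • fieldT := by
  simp only [tensorDefect, hV.tensorD_fieldT, hU.tensorD_fieldT, (hV.bracketAt hU).tensorD_fieldT,
    tensorD_add, tensorD_smul, tensorD_nablaT, rateDefect]
  rw [bracketAt, nablaT_sub]
  module

/-! ### Vanishing of the defects -/

theorem nablaT_fieldT : nablaT bg fieldT = (C bg.a : DiffPoly) • fieldW₁ := by
  funext j
  fin_cases j <;> simp [nablaT, fieldT, fieldW₁, cartanMatrix, Fin.sum_univ_four]

theorem nablaT_fieldW₁ : nablaT bg fieldW₁ = (-k₁) • fieldT + (C (bg.a * bg.ε₁) : DiffPoly) • fieldN := by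
  funext j
  fin_cases j <;> simp [nablaT, fieldT, fieldW₁, fieldN, cartanMatrix, Fin.sum_univ_four]

theorem nablaT_fieldN :
    nablaT bg fieldN = (-(C bg.ε₁ * k₁)) • fieldW₁ + (C bg.ε₂ * k₂) • fieldW₂ := by
  funext j
  fin_cases j <;> simp [nablaT, fieldW₁, fieldN, fieldW₂, cartanMatrix, Fin.sum_univ_four,
    MvPolynomial.smul_eq_C_mul]

theorem sum_frame (X : LocalField) :
    X = X 0 • fieldT + X 1 • fieldW₁ + X 2 • fieldN + X 3 • fieldW₂ := by
  funext j
  fin_cases j <;> simp [fieldT, fieldW₁, fieldN, fieldW₂]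

theorem C_ne_zero {r : ℝ} (hr : r ≠ 0) : (C r : DiffPoly) ≠ 0 := by
  rwa [Ne, MvPolynomial.C_eq_zero]

theorem defect_eq_zero {V U : LocalField} (hV : IsCausal bg V) (hU : IsCausal bg U) :
    rateDefect bg V U = 0 ∧ actDefect bg V U = 0 ∧ tensorDefect bg V U = 0 := by
  have ha : (C bg.a : DiffPoly) ≠ 0 := C_ne_zero bg.a_pos.ne'
  have hε₁ : (C bg.ε₁ : DiffPoly) ≠ 0 := C_ne_zero fun h => by simpa [h] using bg.ε₁_sq
  have hε₂ : (C bg.ε₂ : DiffPoly) ≠ 0 := C_ne_zero fun h => by simpa [h] using bg.ε₂_sq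
  have hC : ∀ r : ℝ, actDefect bg V U (C r) = 0 := fun r => MvPolynomial.derivation_C _ r
  have hT := tensorDefect_fieldT hV hU
  have hP := pairing_tensorDefect (bg := bg) V U
  have hN := tensorDefect_nablaT (bg := bg) V U
  set c := rateDefect bg V U with hc
  set E := tensorDefect bg V U with hE
  have hsm : ∀ f X, E (f • X) = actDefect bg V U f • X + f • E X := tensorDefect_smul V U
  have hadd : ∀ X Y, E (X + Y) = E X + E Y := tensorDefect_add V U
  -- The `W₁`-component of the defect of `W₁` forces the rate defect to vanish.
  have hW₁ := hN fieldT
  rw [hT, nablaT_fieldT, hsm, hC, nablaT_smul, nablaT_fieldT] at hW₁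
  have hc0 : c = 0 := by
    -- As `⟨W₁, W₁⟩` is constant, skewness kills the `W₁`-component of `E W₁`, while `a E W₁ = E
    -- (∇_T T)` has `W₁`-component `2ac`.
    have h1 := hP fieldW₁ fieldW₁
    have h2 := congrFun hW₁ 1
    simp [pairing, fieldW₁, fieldT, MvPolynomial.smul_eq_C_mul, hC] at h1 h2
    have h3 : C bg.a * C bg.ε₁ * c = 0 := by grind
    simpa [ha, hε₁] using h3
  rw [hc0] at hT hN hW₁
  have hW₁' : E fieldW₁ = 0 := by
    have : (C bg.a : DiffPoly) • E fieldW₁ = 0 := by simpa using hW₁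
    exact (smul_eq_zero.mp this).resolve_left ha
  have hT' : E fieldT = 0 := by simpa using hT
  have hN0 : nablaT bg (0 : LocalField) = 0 := by simpa using nablaT_smul (bg := bg) 0 0
  have hEN := hN fieldW₁
  rw [nablaT_fieldW₁, hadd, hsm, hsm, hT', hW₁', hC, hN0] at hEN
  have hNN := hP fieldN fieldN
  -- The `T`-component of `E (∇_T W₁) = 0` combines the defect of `k₁` with the `T`-component of `E
  -- N`, and the latter vanishes because `⟨N, N⟩ = 0` is preserved.
  have hk₁ : actDefect bg V U k₁ = 0 := by
    have h2 := congrFun hEN 0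
    simp [pairing, fieldN, fieldT] at hNN h2
    grind
  have hN' : E fieldN = 0 := by
    have : (C (bg.a * bg.ε₁) : DiffPoly) • E fieldN = 0 := by simpa [hk₁] using hEN
    exact (smul_eq_zero.mp this).resolve_left (by simp [ha, hε₁])
  -- No Cartan equation is needed here: by skewness `E W₂` is orthogonal to the whole frame.
  have hW₂' : E fieldW₂ = 0 := by
    have p0 := hP fieldW₂ fieldT
    have p1 := hP fieldW₂ fieldW₁
    have p2 := hP fieldW₂ fieldN
    have p3 := hP fieldW₂ fieldW₂
    rw [hT'] at p0
    rw [hW₁'] at p1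
    rw [hN'] at p2
    generalize E fieldW₂ = F at *
    simp [pairing, fieldN, fieldT, fieldW₁, fieldW₂, MvPolynomial.smul_eq_C_mul, hC]
      at p0 p1 p2 p3
    have p1' : F 1 = 0 := p1.resolve_left fun h => hε₁ (by rw [h, MvPolynomial.C_0])
    have p3' : C bg.ε₂ * (2 * F 3) = 0 := by linear_combination -p3
    have p3'' : F 3 = 0 := by simpa [hε₂] using p3'
    funext j
    fin_cases j <;> simp [p0, p1', p2, p3'']
  have hk₂ : actDefect bg V U k₂ = 0 := by
    have h := hN fieldN
    rw [nablaT_fieldN, hadd, hsm, hsm, hN', hW₁', hW₂', hN0] at h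
    have h3 := congrFun h 3
    simp [fieldW₁, fieldW₂, hC, Derivation.leibniz] at h3
    simp_all
  -- With `c = 0` the defect of the action commutes with `dσ`, so vanishing on `k₁`, `k₂` propagates
  -- to all generators.
  have hact : actDefect bg V U = 0 := by
    apply MvPolynomial.derivation_ext
    rintro ⟨i, m⟩
    induction m with
    | zero => fin_cases i <;> simpa [k₁, k₂] using ‹_›
    | succ m ih =>
      have hd : dσ (MvPolynomial.X (i, m)) = MvPolynomial.X (i, m + 1) := by simp [dσ]
      rw [← hd, actDefect_dσ, ih, ← hc, hc0]
      simp
  refine ⟨hc0, hact, funext fun X => ?_⟩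
  rw [sum_frame X]
  simp [hadd, hsm, hT', hW₁', hN', hW₂', hact]

/-! ### Linearity in the direction -/

theorem dσ_C_mul (r : ℝ) (f : DiffPoly) : dσ (C r * f) = C r * dσ f := by
  rw [← MvPolynomial.smul_eq_C_mul, Derivation.map_smul, MvPolynomial.smul_eq_C_mul]

theorem act_C_mul (V : LocalField) (r : ℝ) (f : DiffPoly) :
    act bg V (C r * f) = C r * act bg V f := by
  rw [← MvPolynomial.smul_eq_C_mul, Derivation.map_smul, MvPolynomial.smul_eq_C_mul]

/-- The combination `V + r • U` treats additivity and homogeneity at once, here and below. -/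
theorem nablaT_add_smul (r : ℝ) (V U : LocalField) :
    nablaT bg (V + r • U) = nablaT bg V + r • nablaT bg U := by
  funext j
  simp only [nablaT, Pi.add_apply, Pi.smul_apply, map_add, dσ_C_mul, Fin.sum_univ_four,
    MvPolynomial.smul_eq_C_mul]
  ring

theorem phi_add_smul (r : ℝ) (V U : LocalField) :
    phi bg (V + r • U) = phi bg V + r • phi bg U := by
  simp [phi_eq, nablaT_add_smul]

theorem psi_add_smul (r : ℝ) (V U : LocalField) :
    psi bg (V + r • U) = psi bg V + r • psi bg U := by
  simp [psi_eq, nablaT_add_smul]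

theorem rho_add_smul (r : ℝ) (V U : LocalField) :
    rho bg (V + r • U) = rho bg V + r • rho bg U := by
  simp only [rho_eq, nablaT_add_smul, Pi.add_apply, Pi.smul_apply, MvPolynomial.smul_eq_C_mul]
  ring

theorem alpha_add_smul (r : ℝ) (V U : LocalField) :
    alpha bg (V + r • U) = alpha bg V + r • alpha bg U := by
  simp only [alpha, phi_add_smul, rho_add_smul, map_add, Derivation.map_smul]
  module

theorem beta_add_smul (r : ℝ) (V U : LocalField) :
    beta bg (V + r • U) = beta bg V + r • beta bg U := by
  simp only [beta, alpha_add_smul, phi_add_smul, psi_add_smul, map_add, dσ_C_mul,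
    MvPolynomial.smul_eq_C_mul]
  ring

theorem delta_add_smul (r : ℝ) (V U : LocalField) :
    delta bg (V + r • U) = delta bg V + r • delta bg U := by
  simp only [delta, phi_add_smul, psi_add_smul, map_add, dσ_C_mul,
    MvPolynomial.smul_eq_C_mul]
  ring

theorem curvatureVariation_add_smul (r : ℝ) (V U : LocalField) :
    curvatureVariation bg (V + r • U) = curvatureVariation bg V + r • curvatureVariation bg U := by
  funext i
  fin_cases i <;>
  · simp [curvatureVariation, theta, opS, phi_add_smul, psi_add_smul, rho_add_smul,
      MvPolynomial.smul_eq_C_mul]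
    ring

theorem act_add_smul (r : ℝ) (V U : LocalField) :
    act bg (V + r • U) = act bg V + r • act bg U := by
  -- The linear combination of the two actions meets the characterization of the action of `V + r •
  -- U`, which spares an induction on jets.
  refine (act_unique bg _ _ (fun f => ?_) ?_ ?_).symm
  · simp only [Derivation.add_apply, Derivation.smul_apply, act_dσ, rho_add_smul, map_add,
      dσ_C_mul, MvPolynomial.smul_eq_C_mul]
    ring
  all_goals simp [act_k₁, act_k₂, curvatureVariation_add_smul]

theorem frameVariation_add_smul (r : ℝ) (V U : LocalField) :
    frameVariation bg (V + r • U) = frameVariation bg V + r • frameVariation bg U := by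
  ext1 i j
  fin_cases i <;> fin_cases j <;>
  · simp [frameVariation, alpha_add_smul, beta_add_smul, delta_add_smul, phi_add_smul,
      psi_add_smul, MvPolynomial.smul_eq_C_mul]
    try ring

theorem tensorD_add_smul_left (r : ℝ) (V U X : LocalField) :
    tensorD bg (V + r • U) X = tensorD bg V X + r • tensorD bg U X := by
  funext j
  simp only [tensorD, act_add_smul, frameVariation_add_smul, Matrix.add_apply, Matrix.smul_apply,
    Pi.add_apply, Pi.smul_apply, Derivation.add_apply, Derivation.smul_apply, Fin.sum_univ_four,
    MvPolynomial.smul_eq_C_mul]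
  ring

theorem tensorD_add_smul_right (r : ℝ) (V X Y : LocalField) :
    tensorD bg V (X + r • Y) = tensorD bg V X + r • tensorD bg V Y := by
  funext j
  simp only [tensorD, Pi.add_apply, Pi.smul_apply, map_add, act_C_mul,
    Fin.sum_univ_four, MvPolynomial.smul_eq_C_mul]
  ring

theorem bracketAt_self (V : LocalField) : bracketAt bg V V = 0 := sub_self _

theorem bracketAt_add_smul_left (r : ℝ) (V U X : LocalField) :
    bracketAt bg (V + r • U) X = bracketAt bg V X + r • bracketAt bg U X := by
  simp only [bracketAt, tensorD_add_smul_left, tensorD_add_smul_right]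
  module

theorem bracketAt_add_smul_right (r : ℝ) (V X Y : LocalField) :
    bracketAt bg V (X + r • Y) = bracketAt bg V X + r • bracketAt bg V Y := by
  simp only [bracketAt, tensorD_add_smul_left, tensorD_add_smul_right]
  module

/-! ### The bracket on causal fields -/

theorem tensorD_bracketAt {V U : LocalField} (hV : IsCausal bg V) (hU : IsCausal bg U)
    (X : LocalField) :
    tensorD bg (bracketAt bg V U) X = tensorD bg V (tensorD bg U X)
      - tensorD bg U (tensorD bg V X) :=
  (sub_eq_zero.mp (congrFun (defect_eq_zero hV hU).2.2 X)).symm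

theorem act_bracketAt {V U : LocalField} (hV : IsCausal bg V) (hU : IsCausal bg U)
    (f : DiffPoly) :
    act bg (bracketAt bg V U) f = act bg V (act bg U f) - act bg U (act bg V f) := by
  have h := actDefect_apply (bg := bg) V U f
  rw [(defect_eq_zero hV hU).2.1, Derivation.zero_apply] at h
  exact (sub_eq_zero.mp h.symm).symm

theorem rho_eq_zero_iff_rate (V : LocalField) : rho bg V = 0 ↔ rate bg V = 0 := by
  have h : (C (1 / (2 * bg.a)) : DiffPoly) ≠ 0 :=
    C_ne_zero (one_div_ne_zero (mul_ne_zero two_ne_zero bg.a_pos.ne'))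
  rw [rate, mul_eq_zero, or_iff_right h]

/-- The rate is a cocycle, as its defect vanishes. -/
theorem rho_bracketAt_eq_zero {V U : LocalField} (hV : IsCausal bg V) (hU : IsCausal bg U)
    (hρV : rho bg V = 0) (hρU : rho bg U = 0) : rho bg (bracketAt bg V U) = 0 := by
  rw [rho_eq_zero_iff_rate] at *
  simpa [rateDefect, hρV, hρU] using (defect_eq_zero hV hU).1

/-- Once `D_[V,U]` is a commutator, every term is an iterated `D`, and the terms cancel in pairs. -/
theorem bracketAt_jacobi {V U W : LocalField} (hV : IsCausal bg V) (hU : IsCausal bg U)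
    (hW : IsCausal bg W) :
    bracketAt bg (bracketAt bg V U) W + bracketAt bg (bracketAt bg U W) V
      + bracketAt bg (bracketAt bg W V) U = 0 := by
  change tensorD bg (bracketAt bg V U) W - tensorD bg W (bracketAt bg V U)
    + (tensorD bg (bracketAt bg U W) V - tensorD bg V (bracketAt bg U W))
    + (tensorD bg (bracketAt bg W V) U - tensorD bg U (bracketAt bg W V)) = 0
  rw [tensorD_bracketAt hV hU, tensorD_bracketAt hU hW, tensorD_bracketAt hW hV]
  simp only [bracketAt, tensorD_sub]
  abel

theorem isCausal_apply (V : causalFields bg I) (γ : NullCurve bg I) :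
    IsCausal bg ((V : VectorField bg I) γ) :=
  (mem_causalFields _).mp V.2 γ

/-- The bracket of `𝒜`-local vector fields that locally preserve the causal character. -/
def lieBracket (bg : Background) (I : Set ℝ) :
    causalFields bg I →ₗ[ℝ] causalFields bg I →ₗ[ℝ] causalFields bg I :=
  LinearMap.mk₂ ℝ
    (fun V U => ⟨fun γ => bracketAt bg ((V : VectorField bg I) γ) ((U : VectorField bg I) γ),
      (mem_causalFields _).mpr fun γ => (isCausal_apply V γ).bracketAt (isCausal_apply U γ)⟩)
    (fun V V' U => Subtype.ext <| funext fun γ => by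
      simpa using bracketAt_add_smul_left (bg := bg) 1 (V.1 γ) (V'.1 γ) (U.1 γ))
    (fun r V U => Subtype.ext <| funext fun γ => by
      -- The coefficient `-1` yields `[0, U] = 0`; homogeneity is then the combined rule for `0 + r
      -- • V`.
      have h0 := bracketAt_add_smul_left (bg := bg) (-1) (V.1 γ) (V.1 γ) (U.1 γ)
      have h := bracketAt_add_smul_left (bg := bg) r (V.1 γ - V.1 γ) (V.1 γ) (U.1 γ)
      simp only [neg_smul, one_smul, add_neg_cancel] at h0
      simpa [h0] using h)
    (fun V U U' => Subtype.ext <| funext fun γ => by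
      simpa using bracketAt_add_smul_right (bg := bg) 1 (V.1 γ) (U.1 γ) (U'.1 γ))
    (fun r V U => Subtype.ext <| funext fun γ => by
      have h0 := bracketAt_add_smul_right (bg := bg) (-1) (V.1 γ) (U.1 γ) (U.1 γ)
      have h := bracketAt_add_smul_right (bg := bg) r (V.1 γ) (U.1 γ - U.1 γ) (U.1 γ)
      simp only [neg_smul, one_smul, add_neg_cancel] at h0
      simpa [h0] using h)

end NullCurves

end

theorem proposition4 (bg : NullCurves.Background) (I : Set ℝ) (hI : I.OrdConnected)
    (hI' : I.Nontrivial) :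
    ∃ lie : NullCurves.causalFields bg I →ₗ[ℝ] NullCurves.causalFields bg I →ₗ[ℝ]
        NullCurves.causalFields bg I,
      (∀ V U γ, (lie V U : NullCurves.VectorField bg I) γ =
        NullCurves.bracketAt bg ((V : NullCurves.VectorField bg I) γ)
          ((U : NullCurves.VectorField bg I) γ)) ∧
      (∀ V, lie V V = 0) ∧
      (∀ V U W, lie (lie V U) W + lie (lie U W) V + lie (lie W V) U = 0) ∧
      (∀ V U, ∀ f : NullCurves.ScalarField bg I,
        (lie V U : NullCurves.VectorField bg I).act f =
          (V : NullCurves.VectorField bg I).act ((U : NullCurves.VectorField bg I).act f) -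
            (U : NullCurves.VectorField bg I).act ((V : NullCurves.VectorField bg I).act f)) ∧
      NullCurves.evolutionFields bg I ≤ NullCurves.causalFields bg I ∧
      (∀ V U : NullCurves.causalFields bg I,
        (V : NullCurves.VectorField bg I) ∈ NullCurves.evolutionFields bg I →
        (U : NullCurves.VectorField bg I) ∈ NullCurves.evolutionFields bg I →
        (lie V U : NullCurves.VectorField bg I) ∈ NullCurves.evolutionFields bg I) := by
  refine ⟨NullCurves.lieBracket bg I, fun _ _ _ => rfl,
    fun V => Subtype.ext <| funext fun γ => NullCurves.bracketAt_self _,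
    fun V U W => Subtype.ext <| funext fun γ => ?_, fun V U f => funext fun γ => ?_,
    fun V hV => hV.1, fun V U hV hU => ?_⟩
  · exact NullCurves.bracketAt_jacobi (NullCurves.isCausal_apply V γ)
      (NullCurves.isCausal_apply U γ) (NullCurves.isCausal_apply W γ)
  · exact NullCurves.act_bracketAt (NullCurves.isCausal_apply V γ)
      (NullCurves.isCausal_apply U γ) (f γ)
  -- In terms of `ρ = 0`, no antiderivative has to be produced for the bracket.
  · rw [NullCurves.mem_evolutionFields_iff] at *
    exact ⟨Subtype.property _, fun γ => NullCurves.rho_bracketAt_eq_zero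
      (NullCurves.isCausal_apply V γ) (NullCurves.isCausal_apply U γ) (hV.2 γ) (hU.2 γ)⟩
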